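/- Let $J\neq 0$ be a euclidean Jordan algebra, i.e. a finite-dimensional real vector space with a bilinear commutative product satisfying $a(ba^2)=(ab)a^2$ for all $a,b\in J$ and such that $a^2+b^2=0$ implies $a=b=0$; such an algebra has a unit $e$. A primitive idempotent is a nonzero $p$ with $p^2=p$ that is not a sum of two nonzero idempotents $q,q'$ with $qq'=0$, and a Jordan frame is a finite family $(p_i)$ of primitive idempotents with $p_ip_j=0$ for $i\ne j$ and $\sum_i p_i=e$. Every $x\in J$ can be written $x=\sum_i\lambda_i p_i$ with $\lambda_i\in\mathbb{R}$ and $(p_i)$ a Jordan frame, the $\lambda_i$ being unique up to order; put $\operatorname{spec}(x)=\{\lambda_i\}$, $\|x\|=\max_i|\lambda_i|$ (the spectral norm, or JB-norm), and $f(x)=\sum_i f(\lambda_i)p_i$ for a real function $f$ defined on $\operatorname{spec}(x)$ (in particular $\log x$ and $x^{-1/2}$ when all $\lambda_i>0$). Let $P(x)y=2x(xy)-x^2y$, and let $\mathcal{C}=\{x\in J:\operatorname{spec}(x)\subset(0,\infty)\}$ be the cone of $J$. For $a,b\in\mathcal{C}$ let $M(a,b)=\inf\{t>0: tb-a\in\mathcal{C}\}$,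 and let $$d_H(a,b)=\log\bigl(M(a,b)M(b,a)\bigr),\qquad d_T(a,b)=\log\max\bigl(M(a,b),M(b,a)\bigr)$$ be the Hilbert and the Thompson metrics of $\mathcal{C}$. Then for all $a,b\in\mathcal{C}$ one has $P(a^{-1/2})b\in\mathcal{C}$ and $$d_H(a,b)=\operatorname{diam}\log\operatorname{spec}\bigl(P(a^{-1/2})b\bigr),\qquad d_T(a,b)=\bigl\|\log\bigl(P(a^{-1/2})b\bigr)\bigr\|.$$ -/

import Mathlib

noncomputable section

namespace EuclideanJordan

section Metrics

variable {V : Type*} [AddCommGroup V] [Module ℝ V]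

/-- `M(P, Q) = inf {t > 0 | t Q - P ∈ C}`. -/
def gauge (C : Set V) (P Q : V) : ℝ :=
  sInf {t : ℝ | 0 < t ∧ t • Q - P ∈ C}

/-- The Thompson metric of the cone `C`. -/
def thompsonDist (C : Set V) (P Q : V) : ℝ :=
  Real.log (max (gauge C P Q) (gauge C Q P))

/-- The Hilbert (pseudo-)metric of the cone `C`. -/
def hilbertDist (C : Set V) (P Q : V) : ℝ :=
  Real.log (gauge C P Q * gauge C Q P)

end Metrics

/-- A euclidean Jordan algebra: a finite dimensional real vector space with a bilinear commutative
product satisfying the Jordan identity, in which `a² + b² = 0` only if `a = b = 0`.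
No unit is postulated. -/
class IsEuclideanJordanAlgebra (J : Type*) [NonUnitalNonAssocCommRing J] [Module ℝ J] : Prop
    extends IsScalarTower ℝ J J, SMulCommClass ℝ J J, Module.Finite ℝ J, IsCommJordan J where
  formallyReal : ∀ a b : J, a * a + b * b = 0 → a = 0 ∧ b = 0

section Algebra

variable {J : Type*} [NonUnitalNonAssocCommRing J]

/-- A primitive idempotent: a nonzero idempotent that is not the sum of two nonzero orthogonal
idempotents. -/
def IsPrimitiveIdempotent (p : J) : Prop :=
  p * p = p ∧ p ≠ 0 ∧
    ∀ q q' : J, q * q = q → q' * q' = q' → q * q' = 0 → p = q + q' → q = 0 ∨ q' = 0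

/-- A Jordan frame: mutually orthogonal primitive idempotents whose sum is the unit element. -/
structure IsJordanFrame {r : ℕ} (p : Fin r → J) : Prop where
  primitive : ∀ i, IsPrimitiveIdempotent (p i)
  orthogonal : ∀ i j, i ≠ j → p i * p j = 0
  sum_isUnit : ∀ x : J, (∑ i, p i) * x = x

variable [Module ℝ J]

/-- `x = ∑ cᵢ pᵢ` is a spectral decomposition of `x`. -/
def IsSpectralDecomposition {r : ℕ} (x : J) (p : Fin r → J) (c : Fin r → ℝ) : Prop :=
  IsJordanFrame p ∧ x = ∑ i, c i • p i

/-- The spectrum: the set of eigenvalues of `x`. -/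
def spec (x : J) : Set ℝ :=
  {t | ∃ (r : ℕ) (p : Fin r → J) (c : Fin r → ℝ), IsSpectralDecomposition x p c ∧ ∃ i, c i = t}

/-- The spectral norm (JB-norm): the supremum of the moduli of the eigenvalues. -/
def specNorm (x : J) : ℝ :=
  sSup ((fun t : ℝ => |t|) '' spec x)

/-- The cone of the algebra: the elements all of whose eigenvalues are positive. -/
def cone (J : Type*) [NonUnitalNonAssocCommRing J] [Module ℝ J] : Set J :=
  {x | ∀ t ∈ spec x, 0 < t}

/-- `y = ∑ f(cᵢ) pᵢ` for a spectral decomposition `x = ∑ cᵢ pᵢ`. -/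
def IsFunctionOf (f : ℝ → ℝ) (x y : J) : Prop :=
  ∃ (r : ℕ) (p : Fin r → J) (c : Fin r → ℝ),
    IsSpectralDecomposition x p c ∧ y = ∑ i, f (c i) • p i

open Classical in
/-- Functional calculus `f(x) = ∑ f(cᵢ) pᵢ` for `x = ∑ cᵢ pᵢ`. In a euclidean Jordan algebra a
spectral decomposition always exists and the result does not depend on it. -/
def funCalc (f : ℝ → ℝ) (x : J) : J :=
  if h : ∃ y, IsFunctionOf f x y then Classical.choose h else 0

/-- The logarithm of an element of the cone. -/
def log (x : J) : J := funCalc Real.log x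

/-- The power `x ^ s` of an element of the cone, with a real exponent. -/
def rpow (x : J) (s : ℝ) : J := funCalc (fun t => t ^ s) x

/-- The quadratic representation `P(x) = 2 L(x)² - L(x²)`, applied to `y`. -/
def quadRep (x y : J) : J := (2 : ℝ) • (x * (x * y)) - (x * x) * y

end Algebra

end EuclideanJordan

end

namespace EuclideanJordan

open Polynomial

/-! The map P(a^{-1/2}) is a linear bijection that preserves the cone in both directions and sends a
to the unit e. With y = P(a^{-1/2})b this gives M(a,b) = M(e,y) and M(b,a) = M(y,e). In a spectral
decomposition of y these are the inverse of the smallest eigenvalue and the largest eigenvalue, and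
both formulas follow by taking logarithms.

The work lies in the invariance of the cone (`IsOrthogonalSystem.quadRep_mem_cone`). The trace form
tr L(xy) is associative (`trL_mul_assoc`) and positive definite (`trL_mul_self_pos`), and the cone
is the set of y with L(y) positive definite (`mem_cone_iff`). Hence L(w)⁻¹ preserves the cone for w
in the cone (`mem_cone_of_mul_mem_cone`). The joint Peirce decomposition diagonalizes L(w) and P(x)
together, and shows that P(x) = exp(2L(log x)) is the limit of L(w_n)^{-n} with w_n = e - (2/n) log
x. So P(x) maps the cone into its closure, and a small multiple of e split off from the argument
brings the image back into the cone.

The spectral theorem comes from formal reality: the generator of the ideal of relations of one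
element has only simple real roots (`exists_idempotents_of_polynomial`). -/

/-- A complete system of nonzero orthogonal idempotents. -/
structure IsOrthogonalSystem {J : Type*} [NonUnitalNonAssocCommRing J] {r : ℕ} (p : Fin r → J) :
    Prop where
  idem : ∀ i, p i * p i = p i
  ne_zero : ∀ i, p i ≠ 0
  orthogonal : ∀ i j, i ≠ j → p i * p j = 0
  sum_mul : ∀ x : J, (∑ i, p i) * x = x

theorem IsJordanFrame.isOrthogonalSystem {J : Type*} [NonUnitalNonAssocCommRing J]
    {r : ℕ} {p : Fin r → J} (h : IsJordanFrame p) :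
    IsOrthogonalSystem p :=
  ⟨fun i => (h.primitive i).1, fun i => (h.primitive i).2.1, h.orthogonal, h.sum_isUnit⟩

variable {J : Type*} [NonUnitalNonAssocCommRing J] [Module ℝ J] [IsEuclideanJordanAlgebra J]

/-! ### Jordan identities and the Peirce relations of one idempotent -/

/-- The full linearization of the Jordan identity. -/
theorem jordan_linearized (a b c d : J) :
    a * ((b * c) * d) + b * ((c * a) * d) + c * ((a * b) * d) =
      (b * c) * (a * d) + (c * a) * (b * d) + (a * b) * (c * d) := by
  have h := DFunLike.congr_fun (two_nsmul_lie_lmul_lmul_add_add_eq_zero a b c) d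
  simp only [Ring.lie_def, two_nsmul] at h
  change (a * ((b * c) * d) - (b * c) * (a * d) + (b * ((c * a) * d) - (c * a) * (b * d)) +
    (c * ((a * b) * d) - (a * b) * (c * d))) + (a * ((b * c) * d) - (b * c) * (a * d) +
    (b * ((c * a) * d) - (c * a) * (b * d)) + (c * ((a * b) * d) - (a * b) * (c * d))) = 0 at h
  linear_combination (norm := module) (1 / 2 : ℝ) • h

/-- Multiplication by `(b * c) * d`, expressed by multiplications by factors of lower degree. -/
theorem mul_mul_mul_eq (b c d a : J) :
    ((b * c) * d) * a = (b * c) * (d * a) + (b * d) * (c * a) + (c * d) * (b * a)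
      - b * (d * (c * a)) - c * (d * (b * a)) := by
  have h := jordan_linearized a b c d
  rw [mul_comm a, mul_comm c a, mul_comm (a * c) d, mul_comm (a * b) d, mul_comm a d,
    mul_comm (a * c) (b * d), mul_comm (a * b) (c * d), mul_comm a c, mul_comm a b] at h
  linear_combination (norm := module) h

/-- With all three factors equal to p, `mul_mul_mul_eq` says that L(p) is a root of t(2t-1)(t-1):
the Peirce eigenvalues are 0, 1/2 and 1. -/
theorem mul_mul_mul_self_of_idempotent {p : J} (hp : p * p = p) (z : J) :
    p * (p * (p * z)) = (3 / 2 : ℝ) • (p * (p * z)) - (1 / 2 : ℝ) • (p * z) := by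
  have h := mul_mul_mul_eq p p p z
  simp only [hp] at h
  linear_combination (norm := module) (1 / 2 : ℝ) • h

/-- `L(p)` and `L(y)` commute for `y` in the Peirce `1`-space of the idempotent `p`. -/
theorem mul_left_comm_of_mul_eq_self {p y : J} (hp : p * p = p) (hy : p * y = y) (z : J) :
    p * (y * z) = y * (p * z) := by
  have h := jordan_linearized p p y z
  rw [mul_comm y p, hp, hy] at h
  linear_combination (norm := module) h

/-- `L(p)` and `L(y)` commute for `y` in the Peirce `0`-space of the idempotent `p`. -/
theorem mul_left_comm_of_mul_eq_zero {p y : J} (hp : p * p = p) (hy : p * y = 0) (z : J) :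
    p * (y * z) = y * (p * z) := by
  have h := jordan_linearized p p y z
  rw [mul_comm y p, hp, hy] at h
  simp only [zero_mul, mul_zero, zero_add] at h
  exact h.symm

/-- The Peirce spaces of `p` for the eigenvalues `1` and `0` annihilate each other. -/
theorem mul_eq_zero_of_peirce {p y z : J} (hp : p * p = p) (hy : p * y = y) (hz : p * z = 0) :
    y * z = 0 := by
  have h1 := mul_left_comm_of_mul_eq_self hp hy z
  have h2 := mul_left_comm_of_mul_eq_zero hp hz y
  rw [hz, mul_zero] at h1
  rw [hy, mul_comm z y, h1] at h2
  exact h2.symm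

/-! ### Power associativity -/

/-- `mul_mul_mul_eq` writes multiplication by a power of x in terms of L(x), L(x²) and the two
preceding powers, all of which commute with L(x) by the Jordan identity and induction. -/
theorem mul_left_comm_iterate (x : J) (n : ℕ) (z : J) :
    x * ((LinearMap.mulLeft ℝ x ^ n) x * z) = (LinearMap.mulLeft ℝ x ^ n) x * (x * z) := by
  induction n using Nat.twoStepInduction generalizing z with
  | zero => rfl
  | one => simpa using (IsJordan.lmul_lmul_comm_lmul x z).symm
  | more n h0 h1 =>
    rw [pow_succ'] at h1
    rw [pow_succ', pow_succ']
    simp only [Module.End.mul_apply, LinearMap.mulLeft_apply] at h1 ⊢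
    set y := (LinearMap.mulLeft ℝ x ^ n) x
    have hsq := fun z : J => IsJordan.lmul_lmul_comm_lmul x z
    have h := fun z : J => mul_mul_mul_eq y x x z
    rw [mul_comm x (x * y), mul_comm x y, h, h]
    rw [mul_comm x y] at h1
    simp only [mul_add, mul_sub, ← hsq]
    simp only [h0, h1]

/-- Power associativity. -/
theorem iterate_mul_iterate (x : J) (m n : ℕ) :
    (LinearMap.mulLeft ℝ x ^ m) x * (LinearMap.mulLeft ℝ x ^ n) x =
      (LinearMap.mulLeft ℝ x ^ (m + n + 1)) x := by
  induction n with
  | zero => rw [pow_succ', pow_zero, mul_comm]; rfl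
  | succ n ih =>
    rw [pow_succ' _ n, Module.End.mul_apply, LinearMap.mulLeft_apply, ← mul_left_comm_iterate, ih,
      ← add_assoc, pow_succ' _ (m + n + 1)]
    rfl

/-! ### Idempotents in the algebra generated by one element -/

/-- Spectral theorem for a quotient of `ℝ[X]`, with multiplication twisted by `h`, inside a
euclidean Jordan algebra. -/
theorem exists_idempotents_of_polynomial (φ : ℝ[X] →ₗ[ℝ] J) (h : ℝ[X])
    (hmul : ∀ q r, φ q * φ r = φ (h * (q * r))) (hX : ∀ q, φ q = 0 → φ (X * q) = 0) :
    ∃ (S : Finset ℝ) (E : ℝ → J), (∀ c ∈ S, E c * E c = E c ∧ E c ≠ 0) ∧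
      (∀ c ∈ S, ∀ d ∈ S, c ≠ d → E c * E d = 0) ∧
      ∀ q, φ q = ∑ c ∈ S, (h.eval c * q.eval c) • E c := by
  have hsmul : ∀ r q, φ q = 0 → φ (r * q) = 0 := by
    intro r q hq
    induction r using Polynomial.induction_on' with
    | add r s hr hs => rw [add_mul, map_add, hr, hs, add_zero]
    | monomial n a =>
      have : ∀ n : ℕ, φ (X ^ n * q) = 0 := fun n => by
        induction n with
        | zero => simpa using hq
        | succ n ih => rw [pow_succ', mul_assoc]; exact hX _ ih
      rw [← C_mul_X_pow_eq_monomial, mul_assoc, C_mul', map_smul, this, smul_zero]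
  let I : Ideal ℝ[X] :=
    { carrier := {q | φ q = 0}
      add_mem' := fun {a b} ha hb => by
        have ha' : φ a = 0 := ha
        have hb' : φ b = 0 := hb
        change φ (a + b) = 0
        rw [map_add, ha', hb', add_zero]
      zero_mem' := map_zero φ
      smul_mem' := fun r q hq => hsmul r q hq }
  obtain ⟨m, hm⟩ : ∃ m, ∀ q, φ q = 0 ↔ m ∣ q :=
    ⟨Submodule.IsPrincipal.generator I, fun q => Submodule.IsPrincipal.mem_iff_generator_dvd I⟩
  have hm0 : m ≠ 0 := by
    rintro rfl
    have hinj : Function.Injective φ := by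
      rw [injective_iff_map_eq_zero]
      exact fun q hq => zero_dvd_iff.1 ((hm q).1 hq)
    exact Polynomial.not_finite (Module.Finite.of_injective φ hinj)
  -- Formal reality, read off in the quotient by m. The three facts about m below come from it: no
  -- nonreal roots, no common root with h, no multiple roots.
  have hreal : ∀ q r, m ∣ h * (q * q + r * r) → m ∣ q := by
    intro q r hd
    rw [← hm, mul_add, map_add, ← hmul, ← hmul] at hd
    exact (hm q).1 (IsEuclideanJordanAlgebra.formallyReal _ _ hd).1
  have hlt : ∀ f g : ℝ[X], m = f * g → m ∣ g → IsUnit f := by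
    rintro f g hfg ⟨k, hk⟩
    have hg : g ≠ 0 := by rintro rfl; exact hm0 (by rw [hfg, mul_zero])
    refine IsUnit.of_mul_eq_one k (mul_right_cancel₀ hg ?_)
    rw [one_mul]
    conv_rhs => rw [hk, hfg]
    ring
  obtain ⟨r, hr, -, hroots⟩ := exists_prod_multiset_X_sub_C_mul m
  have hr0 : r ≠ 0 := by rintro rfl; exact hm0 (by rw [← hr, mul_zero])
  have hrunit : IsUnit r := by
    by_contra hu
    have hdeg : r.degree ≠ 0 := fun hd => hu (isUnit_iff_degree_eq_zero.2 hd)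
    obtain ⟨z, hz⟩ := IsAlgClosed.exists_aeval_eq_zero ℂ r hdeg
    have him : z.im ≠ 0 := by
      intro him
      have hzr : z = algebraMap ℝ ℂ z.re := by apply Complex.ext <;> simp [him]
      rw [hzr, aeval_algebraMap_apply, map_eq_zero] at hz
      have : z.re ∈ r.roots := (mem_roots hr0).2 (by simpa [IsRoot] using hz)
      simp [hroots] at this
    obtain ⟨k, hk⟩ := quadratic_dvd_of_aeval_eq_zero_im_ne_zero r hz him
    set f : ℝ[X] := X ^ 2 - C (2 * z.re) * X + C (‖z‖ ^ 2)
    have hf : f = (X - C z.re) * (X - C z.re) + C z.im * C z.im := by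
      simp only [f, Complex.sq_norm, Complex.normSq_apply, map_add, map_mul, map_ofNat]
      ring
    set g := (m.roots.map fun a => X - C a).prod * k
    have hfg : m = f * g := by rw [← hr, hk]; ring
    -- The sum of squares (im z · g)² + ((X - re z) g)² equals f g² = m g.
    have hd : m ∣ C z.im * g := by
      refine hreal _ ((X - C z.re) * g) ⟨h * g, ?_⟩
      rw [hfg, hf]; ring
    have hg : m ∣ g := by
      have := hd.mul_left (C z.im⁻¹)
      rwa [← mul_assoc, ← C_mul, inv_mul_cancel₀ him, C_1, one_mul] at this
    have hfu := hlt f g hfg hg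
    have h2 : f.natDegree = 2 := by
      simp only [f]; compute_degree!
    rw [natDegree_eq_zero_of_isUnit hfu] at h2
    omega
  have hcop : ∀ c ∈ m.roots, h.eval c ≠ 0 := by
    intro c hc h0
    obtain ⟨k, hk⟩ := dvd_iff_isRoot.2 (show h.IsRoot c from h0)
    obtain ⟨g, hg⟩ := dvd_iff_isRoot.2 ((mem_roots hm0).1 hc)
    exact not_isUnit_X_sub_C c (hlt _ g hg (hreal g 0 ⟨k * g, by rw [hk, hg]; ring⟩))
  have hnodup : m.roots.Nodup := by
    rw [Multiset.nodup_iff_count_le_one]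
    intro c
    rw [count_roots]
    by_contra! hc
    obtain ⟨g, hg⟩ := (le_rootMultiplicity_iff hm0).1 (show 2 ≤ m.rootMultiplicity c from hc)
    have hg' : m = (X - C c) * ((X - C c) * g) := by rw [hg]; ring
    refine not_isUnit_X_sub_C c (hlt _ _ hg' (hreal _ 0 ⟨h * g, ?_⟩))
    conv_rhs => rw [hg]
    ring
  have hker : ∀ q, φ q = 0 ↔ ∀ c ∈ m.roots.toFinset, q.eval c = 0 := by
    intro q
    rw [hm]
    constructor
    · rintro ⟨k, rfl⟩ c hc
      have : m.eval c = 0 := (mem_roots hm0).1 (Multiset.mem_toFinset.1 hc)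
      simp [this]
    · intro hq
      by_cases hq0 : q = 0
      · simp [hq0]
      have hle : m.roots ≤ q.roots := by
        rw [Multiset.le_iff_subset hnodup]
        exact fun c hc => (mem_roots hq0).2 (hq c (Multiset.mem_toFinset.2 hc))
      rw [← hr]
      exact (hrunit.mul_right_dvd).2 (Multiset.prod_X_sub_C_dvd_iff_le_roots hq0 _ |>.2 hle)
  have hinj : Set.InjOn (id : ℝ → ℝ) (m.roots.toFinset : Set ℝ) := Set.injOn_id _
  have hbas : ∀ c ∈ m.roots.toFinset, ∀ d ∈ m.roots.toFinset,
      (Lagrange.basis m.roots.toFinset id c).eval d = if c = d then 1 else 0 := by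
    intro c hc d hd
    split_ifs with hcd
    · subst hcd; exact Lagrange.eval_basis_self hinj hc
    · exact Lagrange.eval_basis_of_ne (v := id) hcd hd
  have hext : ∀ q r : ℝ[X], (∀ c ∈ m.roots.toFinset, q.eval c = r.eval c) → φ q = φ r := by
    intro q r hqr
    rw [← sub_eq_zero, ← map_sub, hker]
    intro c hc
    rw [eval_sub, hqr c hc, sub_self]
  have hcop' : ∀ c ∈ m.roots.toFinset, h.eval c ≠ 0 := fun c hc =>
    hcop c (Multiset.mem_toFinset.1 hc)
  refine ⟨m.roots.toFinset, fun c => φ (C (h.eval c)⁻¹ * Lagrange.basis m.roots.toFinset id c),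
    fun c hc => ⟨?_, ?_⟩, fun c hc d hd hcd => ?_, fun q => ?_⟩
  · rw [hmul]
    refine hext _ _ fun d hd => ?_
    simp only [eval_mul, eval_C, hbas c hc d hd]
    split_ifs with hcd
    · subst hcd; field_simp [hcop' c hc]
    · simp
  · rw [Ne, hker]
    intro h0
    have := h0 c hc
    simp [hbas c hc c hc, hcop' c hc] at this
  · rw [hmul, hker]
    intro k hk
    simp only [eval_mul, eval_C, hbas c hc k hk, hbas d hd k hk]
    split_ifs with h1 h2
    · exact absurd (h1.trans h2.symm) hcd
    all_goals simp
  · simp only [← map_smul, ← map_sum]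
    refine hext _ _ fun d hd => ?_
    rw [eval_finsetSum, Finset.sum_eq_single d]
    · simp [hbas d hd d hd]; field_simp [hcop' d hd]
    · intro c hc hcd
      simp [hbas c hc d hd, hcd]
    · exact fun hd' => absurd hd hd'

/-- The map `q ↦ q(L(x)) g`. -/
noncomputable def polyMap (x g : J) : ℝ[X] →ₗ[ℝ] J :=
  LinearMap.applyₗ g ∘ₗ (aeval (LinearMap.mulLeft ℝ x)).toLinearMap

theorem polyMap_apply (x g : J) (q : ℝ[X]) :
    polyMap x g q = aeval (LinearMap.mulLeft ℝ x) q g := rfl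

theorem polyMap_monomial (x g : J) (n : ℕ) (a : ℝ) :
    polyMap x g (monomial n a) = a • (LinearMap.mulLeft ℝ x ^ n) g := by
  rw [polyMap_apply, aeval_monomial, Module.algebraMap_end_eq_smul_id]
  rfl

theorem polyMap_X_mul (x g : J) (q : ℝ[X]) : polyMap x g (X * q) = x * polyMap x g q := by
  rw [polyMap_apply, map_mul, aeval_X]
  rfl

theorem polyMap_mul_polyMap (x g : J) (k : ℕ)
    (h : ∀ m n : ℕ, (LinearMap.mulLeft ℝ x ^ m) g * (LinearMap.mulLeft ℝ x ^ n) g =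
      (LinearMap.mulLeft ℝ x ^ (k + (m + n))) g) (q r : ℝ[X]) :
    polyMap x g q * polyMap x g r = polyMap x g (X ^ k * (q * r)) := by
  induction q using Polynomial.induction_on' with
  | add q q' hq hq' => simp only [map_add, add_mul, mul_add, hq, hq']
  | monomial m a =>
    induction r using Polynomial.induction_on' with
    | add r r' hr hr' => simp only [map_add, mul_add, hr, hr']
    | monomial n b =>
      rw [monomial_mul_monomial, ← monomial_one_right_eq_X_pow, monomial_mul_monomial,
        polyMap_monomial, polyMap_monomial, polyMap_monomial, smul_mul_assoc, mul_smul_comm, h,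
        smul_smul, one_mul]

/-- Used with g = x, k = 1 before a unit is available, and with g = e, k = 0 afterwards. -/
theorem polyMap_exists_idempotents (x g : J) (k : ℕ)
    (h : ∀ m n : ℕ, (LinearMap.mulLeft ℝ x ^ m) g * (LinearMap.mulLeft ℝ x ^ n) g =
      (LinearMap.mulLeft ℝ x ^ (k + (m + n))) g) :
    ∃ (S : Finset ℝ) (E : ℝ → J), (∀ c ∈ S, E c * E c = E c ∧ E c ≠ 0) ∧
      (∀ c ∈ S, ∀ d ∈ S, c ≠ d → E c * E d = 0) ∧
      ∀ q, polyMap x g q = ∑ c ∈ S, (c ^ k * q.eval c) • E c := by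
  obtain ⟨S, E, h1, h2, h3⟩ := exists_idempotents_of_polynomial (polyMap x g) (X ^ k)
    (polyMap_mul_polyMap x g k h) (fun q hq => by rw [polyMap_X_mul, hq, mul_zero])
  exact ⟨S, E, h1, h2, fun q => by rw [h3]; simp⟩

/-! ### The trace form and the unit -/

/-- The trace of the multiplication operator. -/
noncomputable def trL (J : Type*) [NonUnitalNonAssocCommRing J] [Module ℝ J]
    [IsEuclideanJordanAlgebra J] : J →ₗ[ℝ] ℝ :=
  LinearMap.trace ℝ J ∘ₗ LinearMap.mul ℝ J

theorem trL_apply (x : J) : trL J x = LinearMap.trace ℝ J (LinearMap.mulLeft ℝ x) := rfl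

/-- The trace form is associative. -/
theorem trL_mul_assoc (b c d : J) : trL J ((b * c) * d) = trL J (b * (c * d)) := by
  let L : J → Module.End ℝ J := fun x => LinearMap.mulLeft ℝ x
  -- In the difference of two expansions by `mul_mul_mul_eq` the terms with a product inside L
  -- cancel; the rest cancels in pairs under the trace, by cyclicity.
  have key : L ((b * c) * d) - L (b * (c * d)) =
      L c * (L b * L d) + L d * (L b * L c) - L b * (L d * L c) - L c * (L d * L b) := by
    ext a
    change ((b * c) * d) * a - (b * (c * d)) * a = c * (b * (d * a)) + d * (b * (c * a))
      - b * (d * (c * a)) - c * (d * (b * a))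
    rw [mul_comm b (c * d), mul_mul_mul_eq b c d a, mul_mul_mul_eq c d b a, mul_comm c b,
      mul_comm d b]
    module
  have h := congrArg (LinearMap.trace ℝ J) key
  simp only [map_sub, map_add] at h
  have h1 : LinearMap.trace ℝ J (L c * (L b * L d)) = LinearMap.trace ℝ J (L b * (L d * L c)) := by
    rw [LinearMap.trace_mul_comm, mul_assoc]
  have h2 : LinearMap.trace ℝ J (L d * (L b * L c)) = LinearMap.trace ℝ J (L c * (L d * L b)) := by
    rw [LinearMap.trace_mul_comm ℝ (L c), mul_assoc]
  rw [h1, h2] at h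
  rw [trL_apply, trL_apply]
  change LinearMap.trace ℝ J (L _) = LinearMap.trace ℝ J (L _)
  linarith

theorem trace_nonneg_of_isIdempotentElem {e : Module.End ℝ J} (he : IsIdempotentElem e) :
    0 ≤ LinearMap.trace ℝ J e := by
  rw [(LinearMap.IsIdempotentElem.isProj_range e he).trace]
  exact Nat.cast_nonneg _

/-- With L = L(p), 2L² - L and 4(L - L²) are the projections onto the Peirce 1- and 1/2-spaces, and
L is the first plus half the second. The first is nonzero because it fixes p. -/
theorem trL_pos_of_idempotent {p : J} (hp : p * p = p) (hp0 : p ≠ 0) : 0 < trL J p := by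
  let L : Module.End ℝ J := LinearMap.mulLeft ℝ p
  have hL : ∀ z, p * (p * (p * z)) = _ := mul_mul_mul_self_of_idempotent hp
  have h1 : IsIdempotentElem ((2 : ℝ) • (L * L) - L) := by
    ext z
    change (2 : ℝ) • (p * (p * ((2 : ℝ) • (p * (p * z)) - p * z))) -
      p * ((2 : ℝ) • (p * (p * z)) - p * z) = (2 : ℝ) • (p * (p * z)) - p * z
    simp only [mul_sub, mul_smul_comm, hL]
    module
  have h2 : IsIdempotentElem ((4 : ℝ) • (L - L * L)) := by
    ext z
    change (4 : ℝ) • (p * ((4 : ℝ) • (p * z - p * (p * z))) -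
      p * (p * ((4 : ℝ) • (p * z - p * (p * z))))) = (4 : ℝ) • (p * z - p * (p * z))
    simp only [mul_sub, mul_smul_comm, hL]
    module
  have hsum : L = ((2 : ℝ) • (L * L) - L) + (1 / 2 : ℝ) • ((4 : ℝ) • (L - L * L)) := by module
  have hne : ((2 : ℝ) • (L * L) - L) ≠ 0 := by
    intro h0
    have : (2 : ℝ) • (p * (p * p)) - p * p = 0 := LinearMap.congr_fun h0 p
    rw [hp, hp] at this
    exact hp0 (by linear_combination (norm := module) this)
  have hpos : 0 < LinearMap.trace ℝ J ((2 : ℝ) • (L * L) - L) :=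
    lt_of_le_of_ne (trace_nonneg_of_isIdempotentElem h1) fun h =>
      hne (LinearMap.IsIdempotentElem.eq_zero_of_trace_eq_zero h1 h.symm)
  have h2' := trace_nonneg_of_isIdempotentElem h2
  rw [trL_apply]
  change 0 < LinearMap.trace ℝ J L
  rw [hsum, map_add, map_smul, smul_eq_mul]
  linarith

/-- The trace form is positive definite. -/
theorem trL_mul_self_pos {x : J} (hx : x ≠ 0) : 0 < trL J (x * x) := by
  obtain ⟨S, E, hE, -, hq⟩ := polyMap_exists_idempotents x x 1 fun m n => by
    rw [iterate_mul_iterate, add_comm]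
  have h1 : x * x = ∑ c ∈ S, (c ^ 1 * c) • E c := by
    have := hq X
    rw [polyMap_apply, aeval_X] at this
    simpa using this
  have h0 : x = ∑ c ∈ S, c • E c := by simpa [polyMap_apply] using hq 1
  have hne : ∃ c ∈ S, c ≠ 0 := by
    by_contra! h
    exact hx (h0.trans (Finset.sum_eq_zero fun c hc => by rw [h c hc, zero_smul]))
  obtain ⟨c, hc, hc0⟩ := hne
  rw [h1, map_sum]
  simp only [map_smul, smul_eq_mul, pow_one]
  refine Finset.sum_pos' (fun d hd => ?_) ⟨c, hc, ?_⟩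
  · exact mul_nonneg (mul_self_nonneg d) (trL_pos_of_idempotent (hE d hd).1 (hE d hd).2).le
  · exact mul_pos (mul_self_pos.2 hc0) (trL_pos_of_idempotent (hE c hc).1 (hE c hc).2)

theorem trL_mul_self_nonneg (x : J) : 0 ≤ trL J (x * x) := by
  by_cases hx : x = 0
  · simp [hx]
  · exact (trL_mul_self_pos hx).le

theorem eq_zero_of_trL {x : J} (h : ∀ y, trL J (x * y) = 0) : x = 0 := by
  by_contra hx
  exact (trL_mul_self_pos hx).ne' (h x)

/-- A euclidean Jordan algebra has a unit. -/
theorem exists_unit (J : Type*) [NonUnitalNonAssocCommRing J] [Module ℝ J]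
    [IsEuclideanJordanAlgebra J] : ∃ e : J, ∀ x, e * x = x := by
  let B : J →ₗ[ℝ] Module.Dual ℝ J := (LinearMap.mul ℝ J).compr₂ (trL J)
  have hinj : Function.Injective B := by
    rw [injective_iff_map_eq_zero]
    exact fun x hx => eq_zero_of_trL fun y => LinearMap.congr_fun hx y
  -- The unit is the vector representing the functional `trL` under the trace form.
  obtain ⟨e, he⟩ := (LinearMap.injective_iff_surjective_of_finrank_eq_finrank
    (Subspace.dual_finrank_eq (K := ℝ) (V := J)).symm).1 hinj (trL J)
  have he' : ∀ x, trL J (e * x) = trL J x := fun x => LinearMap.congr_fun he x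
  refine ⟨e, fun x => sub_eq_zero.1 (eq_zero_of_trL fun y => ?_)⟩
  rw [sub_mul, map_sub, trL_mul_assoc, he', sub_self]

theorem iterate_unit_mul_iterate_unit {e : J} (he : ∀ x : J, e * x = x) (x : J) (m n : ℕ) :
    (LinearMap.mulLeft ℝ x ^ m) e * (LinearMap.mulLeft ℝ x ^ n) e =
      (LinearMap.mulLeft ℝ x ^ (0 + (m + n))) e := by
  have hs : ∀ n : ℕ, (LinearMap.mulLeft ℝ x ^ (n + 1)) e = (LinearMap.mulLeft ℝ x ^ n) x := by
    intro n
    rw [pow_succ, Module.End.mul_apply, LinearMap.mulLeft_apply, mul_comm, he]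
  rw [zero_add]
  cases m with
  | zero => rw [pow_zero, zero_add]; exact he _
  | succ m =>
    cases n with
    | zero => rw [pow_zero, add_zero, mul_comm]; exact he _
    | succ n => rw [hs, hs, iterate_mul_iterate, ← hs]; congr 2; ring

/-! ### Spectral decompositions and the spectrum -/

theorem IsOrthogonalSystem.mul_sum {r : ℕ} {p : Fin r → J} (h : IsOrthogonalSystem p)
    (c : Fin r → ℝ) (i : Fin r) : p i * ∑ j, c j • p j = c i • p i := by
  rw [Finset.mul_sum, Finset.sum_eq_single i]
  · rw [mul_smul_comm, h.idem]
  · intro j _ hj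
    rw [mul_smul_comm, h.orthogonal i j hj.symm, smul_zero]
  · simp

theorem IsOrthogonalSystem.sum_mul_sum {r : ℕ} {p : Fin r → J} (h : IsOrthogonalSystem p)
    (c d : Fin r → ℝ) :
    (∑ i, c i • p i) * ∑ i, d i • p i = ∑ i, (c i * d i) • p i := by
  rw [Finset.sum_mul]
  exact Finset.sum_congr rfl fun i _ => by rw [smul_mul_assoc, h.mul_sum, smul_smul]

theorem IsOrthogonalSystem.linearIndependent {r : ℕ} {p : Fin r → J}
    (h : IsOrthogonalSystem p) : LinearIndependent ℝ p := by
  rw [Fintype.linearIndependent_iff]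
  intro c hc i
  have := h.mul_sum c i
  rw [hc, mul_zero] at this
  exact (smul_eq_zero.1 this.symm).resolve_right (h.ne_zero i)

theorem exists_isOrthogonalSystem (x : J) :
    ∃ (r : ℕ) (p : Fin r → J) (c : Fin r → ℝ), IsOrthogonalSystem p ∧ x = ∑ i, c i • p i := by
  obtain ⟨e, he⟩ := exists_unit J
  obtain ⟨S, E, hE, hEo, hq⟩ := polyMap_exists_idempotents x e 0
    (iterate_unit_mul_iterate_unit he x)
  have h0 : e = ∑ c ∈ S, E c := by simpa [polyMap_apply] using hq 1
  have h1 : x = ∑ c ∈ S, c • E c := by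
    have := hq X
    rw [polyMap_apply, aeval_X, LinearMap.mulLeft_apply, mul_comm, he] at this
    simpa using this
  let σ := S.equivFin
  have hsum : ∀ f : ℝ → J, ∑ c ∈ S, f c = ∑ i, f (σ.symm i) := fun f => by
    rw [← Finset.sum_coe_sort S, ← σ.symm.sum_comp]
  refine ⟨S.card, fun i => E (σ.symm i), fun i => σ.symm i,
    ⟨fun i => (hE _ (σ.symm i).2).1, fun i => (hE _ (σ.symm i).2).2, fun i j hij => ?_, ?_⟩, ?_⟩
  · exact hEo _ (σ.symm i).2 _ (σ.symm j).2 fun h => hij (σ.symm.injective (Subtype.ext h))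
  · rw [← hsum, ← h0]; exact he
  · rw [← hsum fun c => c • E c]; exact h1

/-- Splitting an idempotent of an orthogonal system. -/
theorem IsOrthogonalSystem.split {r : ℕ} {p : Fin r → J} (h : IsOrthogonalSystem p)
    (i : Fin r) {q q' : J} (hq : q * q = q) (hq' : q' * q' = q') (hqq : q * q' = 0)
    (hp : p i = q + q') (h0 : q ≠ 0) (h0' : q' ≠ 0) :
    IsOrthogonalSystem (Fin.cons q' (Function.update p i q) : Fin (r + 1) → J) := by
  have hpq : p i * q = q := by rw [hp, add_mul, hq, mul_comm q', hqq, add_zero]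
  have hpq' : p i * q' = q' := by rw [hp, add_mul, hq', hqq, zero_add]
  have hqj : ∀ j, j ≠ i → q * p j = 0 := fun j hj =>
    mul_eq_zero_of_peirce (h.idem i) hpq (h.orthogonal i j hj.symm)
  have hqj' : ∀ j, j ≠ i → q' * p j = 0 := fun j hj =>
    mul_eq_zero_of_peirce (h.idem i) hpq' (h.orthogonal i j hj.symm)
  have hoff : ∀ j, q' * Function.update p i q j = 0 := by
    intro j
    by_cases hj : j = i
    · subst hj; rw [Function.update_self, mul_comm, hqq]
    · rw [Function.update_of_ne hj, hqj' j hj]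
  refine ⟨fun j => ?_, fun j => ?_, fun j k hjk => ?_, fun x => ?_⟩
  · refine Fin.cases ?_ (fun j => ?_) j
    · simpa using hq'
    · by_cases hj : j = i
      · subst hj; simpa using hq
      · simpa [Function.update_of_ne hj] using h.idem j
  · refine Fin.cases ?_ (fun j => ?_) j
    · simpa using h0'
    · by_cases hj : j = i
      · subst hj; simpa using h0
      · simpa [Function.update_of_ne hj] using h.ne_zero j
  · revert hjk
    refine Fin.cases ?_ (fun j => ?_) j <;> refine Fin.cases ?_ (fun k => ?_) k
    · exact fun h => absurd rfl h
    · intro _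
      simpa using hoff k
    · intro _
      simpa [mul_comm] using hoff j
    · intro hjk
      have hjk' : j ≠ k := fun h => hjk (by rw [h])
      simp only [Fin.cons_succ]
      by_cases hj : j = i
      · subst hj
        rw [Function.update_self, Function.update_of_ne hjk'.symm, hqj k hjk'.symm]
      · by_cases hk : k = i
        · subst hk
          rw [Function.update_self, Function.update_of_ne hj, mul_comm, hqj j hj]
        · rw [Function.update_of_ne hj, Function.update_of_ne hk, h.orthogonal j k hjk']
  · have : ∑ j, (Fin.cons q' (Function.update p i q) : Fin (r + 1) → J) j = ∑ j, p j := by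
      rw [Fin.sum_univ_succ]
      simp only [Fin.cons_zero, Fin.cons_succ]
      rw [Finset.sum_update_of_mem (Finset.mem_univ i), ← Finset.add_sum_erase _ p
        (Finset.mem_univ i), hp, Finset.sdiff_singleton_eq_erase]
      abel
    rw [this, h.sum_mul]

/-- Every element of a euclidean Jordan algebra has a spectral decomposition. -/
theorem exists_isSpectralDecomposition (x : J) :
    ∃ (r : ℕ) (p : Fin r → J) (c : Fin r → ℝ), IsSpectralDecomposition x p c := by
  classical
  -- A decomposition of maximal length, bounded by the dimension, has primitive members: otherwise
  -- one splits, both pieces keeping its coefficient.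
  let Q : ℕ → Prop := fun r =>
    ∃ (p : Fin r → J) (c : Fin r → ℝ), IsOrthogonalSystem p ∧ x = ∑ i, c i • p i
  have hbound : ∀ r, Q r → r ≤ Module.finrank ℝ J := by
    rintro r ⟨p, c, hp, -⟩
    simpa using hp.linearIndependent.fintype_card_le_finrank
  obtain ⟨r₀, hr₀⟩ := exists_isOrthogonalSystem x
  obtain ⟨r, ⟨p, c, hp, hx⟩, hmax⟩ : ∃ r, Q r ∧ ∀ s, Q s → s ≤ r :=
    ⟨_, Nat.findGreatest_spec (P := Q) (hbound r₀ hr₀) hr₀,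
      fun s hs => Nat.le_findGreatest (hbound s hs) hs⟩
  refine ⟨r, p, c, ⟨fun i => ⟨hp.idem i, hp.ne_zero i, fun q q' hq hq' hqq hpi => ?_⟩,
    hp.orthogonal, hp.sum_mul⟩, hx⟩
  by_contra! h0
  have hQ : Q (r + 1) := by
    refine ⟨_, Fin.cons (c i) c, hp.split i hq hq' hqq hpi h0.1 h0.2, ?_⟩
    rw [Fin.sum_univ_succ]
    simp only [Fin.cons_zero, Fin.cons_succ]
    have : ∀ j, c j • Function.update p i q j =
        Function.update (fun j => c j • p j) i (c i • q) j := fun j => by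
      by_cases hj : j = i
      · subst hj; simp
      · simp [Function.update_of_ne hj]
    simp only [this]
    rw [Finset.sum_update_of_mem (Finset.mem_univ i), hx, ← Finset.add_sum_erase _ _
        (Finset.mem_univ i), hpi, Finset.sdiff_singleton_eq_erase, smul_add]
    abel
  exact absurd (hmax _ hQ) (by omega)

theorem IsOrthogonalSystem.polyMap_eq {r : ℕ} {p : Fin r → J} (h : IsOrthogonalSystem p)
    {e : J} (he : ∀ x, e * x = x) (c : Fin r → ℝ) (q : ℝ[X]) :
    polyMap (∑ i, c i • p i) e q = ∑ i, q.eval (c i) • p i := by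
  have hpe : ∑ i, p i = e := by rw [← h.sum_mul e, mul_comm, he]
  have hpow : ∀ n : ℕ, (LinearMap.mulLeft ℝ (∑ i, c i • p i) ^ n) e = ∑ i, c i ^ n • p i := by
    intro n
    induction n with
    | zero => simp [hpe]
    | succ n ih =>
      rw [pow_succ', Module.End.mul_apply, LinearMap.mulLeft_apply, ih, h.sum_mul_sum]
      simp only [pow_succ']
  induction q using Polynomial.induction_on' with
  | add q q' hq hq' => simp only [map_add, hq, hq', eval_add, add_smul, Finset.sum_add_distrib]
  | monomial n a =>
    rw [polyMap_monomial, hpow, Finset.smul_sum]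
    exact Finset.sum_congr rfl fun i _ => by rw [smul_smul, eval_monomial]

/-- The polynomial with roots d j annihilates the element, so it vanishes at every c i. -/
theorem IsOrthogonalSystem.exists_eq {r s : ℕ} {p : Fin r → J} {q : Fin s → J}
    (hp : IsOrthogonalSystem p) (hq : IsOrthogonalSystem q) {c : Fin r → ℝ} {d : Fin s → ℝ}
    (h : ∑ i, c i • p i = ∑ j, d j • q j) (i : Fin r) : ∃ j, d j = c i := by
  obtain ⟨e, he⟩ := exists_unit J
  set m : ℝ[X] := ∏ j, (X - C (d j))
  have h1 := hp.polyMap_eq he c m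
  rw [h, hq.polyMap_eq he d m, Finset.sum_eq_zero] at h1
  · have h2 := hp.mul_sum (fun i => m.eval (c i)) i
    rw [← h1, mul_zero] at h2
    have h3 := (smul_eq_zero.1 h2.symm).resolve_right (hp.ne_zero i)
    rw [eval_prod, Finset.prod_eq_zero_iff] at h3
    obtain ⟨j, -, hj⟩ := h3
    simp only [eval_sub, eval_X, eval_C] at hj
    exact ⟨j, by linarith⟩
  · intro j _
    rw [eval_prod, Finset.prod_eq_zero (Finset.mem_univ j) (by simp), zero_smul]

/-- The spectrum can be read off any spectral decomposition. -/
theorem IsSpectralDecomposition.spec_eq {r : ℕ} {x : J} {p : Fin r → J} {c : Fin r → ℝ}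
    (h : IsSpectralDecomposition x p c) : spec x = Set.range c := by
  ext t
  constructor
  · rintro ⟨s, q, d, hd, i, rfl⟩
    exact hd.1.isOrthogonalSystem.exists_eq h.1.isOrthogonalSystem (hd.2.symm.trans h.2) i
  · rintro ⟨i, rfl⟩
    exact ⟨r, p, c, h, i, rfl⟩

/-! ### The cone in terms of the trace form -/

theorem trL_mul_mul_comm (x y z : J) : trL J ((x * y) * z) = trL J (y * (x * z)) := by
  rw [mul_comm x y, trL_mul_assoc]

/-- `L(p)` is positive semidefinite for an idempotent `p`. -/
theorem trL_idempotent_mul_nonneg {p : J} (hp : p * p = p) (z : J) :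
    0 ≤ trL J ((p * z) * z) := by
  have hL := mul_mul_mul_self_of_idempotent hp z
  have e1 : trL J ((p * z) * (p * z)) = trL J ((p * (p * z)) * z) := by
    rw [trL_mul_mul_comm p (p * z) z]
  have e2 : trL J ((p * z) * (p * (p * z))) =
      3 / 2 * trL J ((p * (p * z)) * z) - 1 / 2 * trL J ((p * z) * z) := by
    rw [trL_mul_mul_comm, hL, mul_sub, mul_smul_comm, mul_smul_comm, map_sub, map_smul, map_smul,
      smul_eq_mul, smul_eq_mul, mul_comm z, mul_comm z]
  have e3 : trL J ((p * (p * z)) * (p * (p * z))) =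
      3 / 2 * trL J ((p * z) * (p * (p * z))) - 1 / 2 * trL J ((p * z) * (p * z)) := by
    rw [trL_mul_mul_comm, hL, mul_sub, mul_smul_comm, mul_smul_comm, map_sub, map_smul, map_smul,
      smul_eq_mul, smul_eq_mul]
  -- By self-adjointness and the cubic relation, L(p) = (2L² - L)² + 8(L - L²)² with L = L(p).
  have n1 := trL_mul_self_nonneg ((2 : ℝ) • (p * (p * z)) - p * z)
  have n2 := trL_mul_self_nonneg (p * z - p * (p * z))
  simp only [mul_sub, sub_mul, mul_smul_comm, smul_mul_assoc, map_sub, map_smul, smul_eq_mul,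
    mul_comm (p * (p * z)) (p * z)] at n1 n2
  linarith

theorem IsOrthogonalSystem.trL_mul_pos {r : ℕ} {p : Fin r → J} (h : IsOrthogonalSystem p)
    {c : Fin r → ℝ} (hc : ∀ i, 0 < c i) {z : J} (hz : z ≠ 0) :
    0 < trL J (((∑ i, c i • p i) * z) * z) := by
  have hn : ∀ i, 0 ≤ trL J ((p i * z) * z) := fun i => trL_idempotent_mul_nonneg (h.idem i) z
  have hs : 0 < ∑ i, trL J ((p i * z) * z) := by
    rw [← map_sum, ← Finset.sum_mul, ← Finset.sum_mul, h.sum_mul]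
    exact trL_mul_self_pos hz
  obtain ⟨k, -, hk⟩ := Finset.exists_lt_of_sum_lt (s := Finset.univ) (f := fun _ => (0 : ℝ))
    (by simpa using hs)
  rw [Finset.sum_mul, Finset.sum_mul, map_sum]
  simp only [smul_mul_assoc, map_smul, smul_eq_mul]
  exact Finset.sum_pos' (fun i _ => mul_nonneg (hc i).le (hn i))
    ⟨k, Finset.mem_univ k, mul_pos (hc k) hk⟩

/-- The cone consists of the elements with positive definite multiplication operator. -/
theorem mem_cone_iff {y : J} : y ∈ cone J ↔ ∀ z, z ≠ 0 → 0 < trL J ((y * z) * z) := by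
  obtain ⟨r, p, c, h⟩ := exists_isSpectralDecomposition y
  have hp := h.1.isOrthogonalSystem
  constructor
  · intro hy z hz
    rw [h.2]
    exact hp.trL_mul_pos (fun i => hy _ ⟨r, p, c, h, i, rfl⟩) hz
  · intro hy t ht
    rw [h.spec_eq] at ht
    obtain ⟨i, rfl⟩ := ht
    have h1 := hy (p i) (hp.ne_zero i)
    rw [h.2, mul_comm (∑ i, c i • p i), hp.mul_sum, smul_mul_assoc, hp.idem, map_smul, smul_eq_mul] at h1
    exact pos_of_mul_pos_left h1 (trL_pos_of_idempotent (hp.idem i) (hp.ne_zero i)).le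

theorem IsOrthogonalSystem.sum_mem_cone {r : ℕ} {p : Fin r → J} (h : IsOrthogonalSystem p)
    {c : Fin r → ℝ} (hc : ∀ i, 0 < c i) : ∑ i, c i • p i ∈ cone J :=
  mem_cone_iff.2 fun _ hz => h.trL_mul_pos hc hz

theorem IsJordanFrame.sum_mem_cone_iff {r : ℕ} {p : Fin r → J} (h : IsJordanFrame p)
    {c : Fin r → ℝ} : ∑ i, c i • p i ∈ cone J ↔ ∀ i, 0 < c i :=
  ⟨fun hm i => hm _ ⟨r, p, c, ⟨h, rfl⟩, i, rfl⟩, h.isOrthogonalSystem.sum_mem_cone⟩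

/-- `L(w)⁻¹` preserves the cone for `w` in the cone. -/
theorem mem_cone_of_mul_mem_cone {w v : J} (hw : w ∈ cone J) (h : w * v ∈ cone J) :
    v ∈ cone J := by
  obtain ⟨r, p, c, hv⟩ := exists_isSpectralDecomposition v
  have hp := hv.1.isOrthogonalSystem
  rw [hv.2, hv.1.sum_mem_cone_iff]
  intro i
  -- Testing on p i, an eigenvector of L(v), gives tr((wv) p i) = c i · tr(w p i), with both traces
  -- positive.
  have h1 := mem_cone_iff.1 h (p i) (hp.ne_zero i)
  have h2 := mem_cone_iff.1 hw (p i) (hp.ne_zero i)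
  rw [trL_mul_assoc, hp.idem] at h1 h2
  rw [trL_mul_assoc, mul_comm v, hv.2, hp.mul_sum, mul_smul_comm, map_smul, smul_eq_mul] at h1
  exact pos_of_mul_pos_left h1 h2.le

/-! ### The joint Peirce decomposition -/

/-- The Peirce components of `v` with respect to `p`; those with `i ≠ j` are halved, so that the
sum over all ordered pairs is `v`. -/
noncomputable def peirce {r : ℕ} (p : Fin r → J) (i j : Fin r) (v : J) : J :=
  (2 : ℝ) • (p i * (p j * v)) - if i = j then p i * v else 0

omit [IsEuclideanJordanAlgebra J] in
theorem IsOrthogonalSystem.sum_peirce {r : ℕ} {p : Fin r → J} (h : IsOrthogonalSystem p) (v : J) :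
    ∑ i, ∑ j, peirce p i j v = v := by
  simp only [peirce, Finset.sum_sub_distrib, Finset.sum_ite_eq, Finset.mem_univ, if_true,
    ← Finset.smul_sum, ← Finset.mul_sum, ← Finset.sum_mul, h.sum_mul]
  module

/-- The Peirce 1-component 2p(pv) - pv of v is annihilated by q, which lies in the 0-space; then
L(q) is moved past L(p). -/
theorem mul_mul_mul_of_orthogonal {p q : J} (hp : p * p = p) (hpq : p * q = 0) (v : J) :
    p * (p * (q * v)) = (1 / 2 : ℝ) • (p * (q * v)) := by
  have hc := mul_left_comm_of_mul_eq_zero hp hpq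
  have hy : p * ((2 : ℝ) • (p * (p * v)) - p * v) = (2 : ℝ) • (p * (p * v)) - p * v := by
    rw [mul_sub, mul_smul_comm, mul_mul_mul_self_of_idempotent hp]
    module
  have h0 := mul_eq_zero_of_peirce hp hy hpq
  rw [mul_comm, mul_sub, mul_smul_comm, ← hc, ← hc] at h0
  linear_combination (norm := module) (1 / 2 : ℝ) • h0

/-- Polarization of `mul_mul_mul_of_orthogonal`, applied to the idempotent p + q. -/
theorem mul_mul_mul_of_orthogonal_triple {p q s : J} (hp : p * p = p) (hq : q * q = q)
    (hpq : p * q = 0) (hps : p * s = 0) (hqs : q * s = 0) (v : J) : p * (q * (s * v)) = 0 := by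
  have h1 := mul_mul_mul_of_orthogonal hp hps v
  have h2 := mul_mul_mul_of_orthogonal hq hqs v
  have h3 := mul_mul_mul_of_orthogonal (p := p + q) (q := s)
    (by rw [mul_add, add_mul, add_mul, hp, hq, mul_comm q p, hpq]; abel)
    (by rw [add_mul, hps, hqs, add_zero]) v
  have h4 := mul_left_comm_of_mul_eq_zero hp hpq (s * v)
  simp only [mul_add, add_mul] at h3
  linear_combination (norm := module) (1 / 2 : ℝ) • (h3 - h1 - h2 + h4)

theorem IsOrthogonalSystem.mul_peirce {r : ℕ} {p : Fin r → J} (h : IsOrthogonalSystem p)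
    (i j k : Fin r) (v : J) :
    p k * peirce p i j v =
      (((if k = i then 1 else 0) + (if k = j then 1 else 0)) / 2 : ℝ) • peirce p i j v := by
  have hcomm : ∀ i j, i ≠ j → ∀ z, p i * (p j * z) = p j * (p i * z) := fun i j hij =>
    mul_left_comm_of_mul_eq_zero (h.idem i) (h.orthogonal i j hij)
  unfold peirce
  by_cases hij : i = j
  · subst hij
    by_cases hk : k = i
    · subst hk
      simp only [if_true, mul_sub, mul_smul_comm, mul_mul_mul_self_of_idempotent (h.idem k)]
      module
    · have h1 := mul_mul_mul_of_orthogonal (h.idem i) (h.orthogonal i k (Ne.symm hk)) v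
      simp only [if_true, hk, if_false, mul_sub, mul_smul_comm]
      rw [hcomm k i hk, hcomm k i hk, h1]
      module
  · simp only [hij, if_false, sub_zero, mul_smul_comm]
    by_cases hk : k = i
    · subst hk
      simp only [hij, if_true, if_false]
      rw [mul_mul_mul_of_orthogonal (h.idem k) (h.orthogonal k j hij)]
      module
    · by_cases hk' : k = j
      · subst hk'
        simp only [hk, if_true, if_false]
        rw [hcomm i k (Ne.symm hk), mul_mul_mul_of_orthogonal (h.idem k) (h.orthogonal k i hk)]
        module
      · simp only [hk, hk', if_false]
        rw [mul_mul_mul_of_orthogonal_triple (h.idem k) (h.idem i) (h.orthogonal k i hk)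
          (h.orthogonal k j hk') (h.orthogonal i j hij)]
        module

theorem IsOrthogonalSystem.sum_mul_peirce {r : ℕ} {p : Fin r → J} (h : IsOrthogonalSystem p)
    (c : Fin r → ℝ) (i j : Fin r) (v : J) :
    (∑ k, c k • p k) * peirce p i j v = ((c i + c j) / 2) • peirce p i j v := by
  rw [Finset.sum_mul]
  simp only [smul_mul_assoc, h.mul_peirce, smul_smul]
  rw [← Finset.sum_smul]
  congr 1
  simp [mul_div_assoc', mul_add, ← Finset.sum_div, Finset.sum_add_distrib]

/-! ### The quadratic representation -/

/-- The quadratic representation in terms of the Peirce decomposition. -/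
theorem IsOrthogonalSystem.quadRep_peirce {r : ℕ} {p : Fin r → J} (h : IsOrthogonalSystem p)
    (c : Fin r → ℝ) (i j : Fin r) (v : J) :
    quadRep (∑ k, c k • p k) (peirce p i j v) = (c i * c j) • peirce p i j v := by
  rw [quadRep, h.sum_mul_sum, h.sum_mul_peirce, h.sum_mul_peirce, mul_smul_comm,
    h.sum_mul_peirce]
  module

omit [IsEuclideanJordanAlgebra J] in
theorem quadRep_add (x y z : J) : quadRep x (y + z) = quadRep x y + quadRep x z := by
  simp only [quadRep, mul_add]
  module

theorem quadRep_smul (x : J) (t : ℝ) (y : J) : quadRep x (t • y) = t • quadRep x y := by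
  simp only [quadRep, mul_smul_comm]
  module

omit [IsEuclideanJordanAlgebra J] in
theorem quadRep_sub (x y z : J) : quadRep x (y - z) = quadRep x y - quadRep x z := by
  simp only [quadRep, mul_sub]
  module

omit [IsEuclideanJordanAlgebra J] in
theorem quadRep_sum {ι : Type*} (s : Finset ι) (x : J) (f : ι → J) :
    quadRep x (∑ i ∈ s, f i) = ∑ i ∈ s, quadRep x (f i) := by
  simp only [quadRep, Finset.mul_sum, Finset.smul_sum, Finset.sum_sub_distrib]

theorem IsOrthogonalSystem.quadRep_sum_peirce {r : ℕ} {p : Fin r → J}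
    (h : IsOrthogonalSystem p) (c : Fin r → ℝ) (a : Fin r → Fin r → ℝ) (v : J) :
    quadRep (∑ k, c k • p k) (∑ i, ∑ j, a i j • peirce p i j v) =
      ∑ i, ∑ j, (a i j * (c i * c j)) • peirce p i j v := by
  simp only [quadRep_sum, quadRep_smul, h.quadRep_peirce, smul_smul]

theorem IsOrthogonalSystem.quadRep_eq_sum {r : ℕ} {p : Fin r → J} (h : IsOrthogonalSystem p)
    (c : Fin r → ℝ) (v : J) :
    quadRep (∑ k, c k • p k) v = ∑ i, ∑ j, (c i * c j) • peirce p i j v := by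
  conv_lhs => rw [← h.sum_peirce v]
  simp only [quadRep_sum, h.quadRep_peirce]

theorem IsOrthogonalSystem.quadRep_quadRep_inv {r : ℕ} {p : Fin r → J}
    (h : IsOrthogonalSystem p) {c d : Fin r → ℝ} (hcd : ∀ i, c i * d i = 1) (v : J) :
    quadRep (∑ k, d k • p k) (quadRep (∑ k, c k • p k) v) = v := by
  rw [h.quadRep_eq_sum c, h.quadRep_sum_peirce]
  conv_rhs => rw [← h.sum_peirce v]
  refine Finset.sum_congr rfl fun i _ => Finset.sum_congr rfl fun j _ => ?_
  rw [show c i * c j * (d i * d j) = (c i * d i) * (c j * d j) by ring, hcd, hcd, one_mul, one_smul]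

theorem IsOrthogonalSystem.quadRep_sum_smul {r : ℕ} {p : Fin r → J}
    (h : IsOrthogonalSystem p) (c d : Fin r → ℝ) :
    quadRep (∑ k, c k • p k) (∑ k, d k • p k) = ∑ k, (c k * c k * d k) • p k := by
  simp only [quadRep, h.sum_mul_sum, Finset.smul_sum, ← Finset.sum_sub_distrib]
  exact Finset.sum_congr rfl fun i _ => by module

/-! ### Invariance of the cone -/

/-- The sum is L(w)^{-n} y for w = ∑ w i • p i, since L(w) acts on the (i, j) component as (w i + w
j)/2. -/
theorem IsOrthogonalSystem.mem_cone_of_iterate {r : ℕ} {p : Fin r → J}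
    (h : IsOrthogonalSystem p) {w : Fin r → ℝ} (hw : ∀ i, 0 < w i) (n : ℕ) {y : J}
    (hy : y ∈ cone J) :
    ∑ i, ∑ j, (((w i + w j) / 2) ^ n)⁻¹ • peirce p i j y ∈ cone J := by
  induction n with
  | zero => simpa [h.sum_peirce] using hy
  | succ n ih =>
    refine mem_cone_of_mul_mem_cone (h.sum_mem_cone hw) ?_
    convert ih using 1
    simp only [Finset.mul_sum _ _ (∑ i, w i • p i), mul_smul_comm, h.sum_mul_peirce, smul_smul]
    refine Finset.sum_congr rfl fun i _ => Finset.sum_congr rfl fun j _ => ?_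
    have : (w i + w j) / 2 ≠ 0 := (half_pos (add_pos (hw i) (hw j))).ne'
    rw [pow_succ, mul_inv, mul_assoc, inv_mul_cancel₀ this, mul_one]

open Filter Topology in
/-- `P(x)` maps the cone into its closure for `x` in the cone. -/
theorem IsOrthogonalSystem.quadRep_nonneg {r : ℕ} {p : Fin r → J} (h : IsOrthogonalSystem p)
    {c : Fin r → ℝ} (hc : ∀ i, 0 < c i) {y : J} (hy : y ∈ cone J) (z : J) :
    0 ≤ trL J ((quadRep (∑ k, c k • p k) y * z) * z) := by
  by_cases hz : z = 0
  · simp [hz]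
  have expand : ∀ a : Fin r → Fin r → ℝ,
      trL J (((∑ i, ∑ j, a i j • peirce p i j y) * z) * z) =
        ∑ i, ∑ j, a i j * trL J ((peirce p i j y * z) * z) := fun a => by
    simp only [Finset.sum_mul, smul_mul_assoc, map_sum, map_smul, smul_eq_mul]
  -- Chosen so that ((w i + w j)/2)^n = (1 - (log c i + log c j)/n)^n tends to 1/(c i c j), the
  -- inverse of the eigenvalue of P(x).
  let w : ℕ → Fin r → ℝ := fun n i => 1 + (-(2 * Real.log (c i))) / n
  have hw : ∀ᶠ n : ℕ in atTop, ∀ i, 0 < w n i := by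
    rw [eventually_all]
    intro i
    have : Tendsto (fun n : ℕ => w n i) atTop (𝓝 (1 + 0)) :=
      tendsto_const_nhds.add (tendsto_const_div_atTop_nhds_zero_nat _)
    rw [add_zero] at this
    exact this.eventually (lt_mem_nhds one_pos)
  have hlim : Tendsto (fun n : ℕ => ∑ i, ∑ j, (((w n i + w n j) / 2) ^ n)⁻¹ *
      trL J ((peirce p i j y * z) * z)) atTop
      (𝓝 (∑ i, ∑ j, (c i * c j) * trL J ((peirce p i j y * z) * z))) := by
    refine tendsto_finsetSum _ fun i _ => tendsto_finsetSum _ fun j _ =>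
      Tendsto.mul_const _ ?_
    have h1 := (Real.tendsto_one_add_div_pow_exp (-(Real.log (c i) + Real.log (c j)))).inv₀
      (Real.exp_ne_zero _)
    rw [Real.exp_neg, inv_inv, Real.exp_add, Real.exp_log (hc i), Real.exp_log (hc j)] at h1
    refine h1.congr fun n => ?_
    simp only [w]
    congr 2
    ring
  rw [h.quadRep_eq_sum, expand]
  refine ge_of_tendsto hlim (hw.mono fun n hn => ?_)
  rw [← expand]
  exact (mem_cone_iff.1 (h.mem_cone_of_iterate hn n hy) z hz).le

/-- `P(x)` preserves the cone for `x` in the cone. -/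
theorem IsOrthogonalSystem.quadRep_mem_cone {r : ℕ} {p : Fin r → J} (h : IsOrthogonalSystem p)
    {c : Fin r → ℝ} (hc : ∀ i, 0 < c i) {y : J} (hy : y ∈ cone J) :
    quadRep (∑ k, c k • p k) y ∈ cone J := by
  obtain ⟨s, q, d, hd⟩ := exists_isSpectralDecomposition y
  have hd0 : ∀ i, 0 < d i := hd.1.sum_mem_cone_iff.1 (hd.2 ▸ hy)
  have hq := hd.1.isOrthogonalSystem
  -- With ε below the spectrum, y - εe stays in the cone, while P(x)(εe) = εx² is positive definite.
  -- An empty frame (J = 0) allows any ε.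
  obtain ⟨ε, hε, hlt⟩ : ∃ ε : ℝ, 0 < ε ∧ ∀ i, ε < d i := by
    rcases isEmpty_or_nonempty (Fin s) with hs | hs
    · exact ⟨1, one_pos, fun i => hs.elim i⟩
    · obtain ⟨k, hk⟩ := Finite.exists_min d
      exact ⟨d k / 2, half_pos (hd0 k), fun i => (half_lt_self (hd0 k)).trans_le (hk i)⟩
  have hunit : ∑ k, q k = ∑ k, p k := by
    rw [← hq.sum_mul (∑ k, p k), mul_comm, h.sum_mul]
  have hdec : y = ∑ k, (d k - ε) • q k + ∑ k, ε • p k := by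
    rw [← Finset.smul_sum, ← hunit, Finset.smul_sum, ← Finset.sum_add_distrib, hd.2]
    exact Finset.sum_congr rfl fun i _ => by module
  rw [mem_cone_iff]
  intro z hz
  have h1 := h.quadRep_nonneg hc (hq.sum_mem_cone fun i => sub_pos.2 (hlt i)) z
  have h2 := h.trL_mul_pos (c := fun k => c k * c k * ε)
    (fun i => mul_pos (mul_pos (hc i) (hc i)) hε) hz
  rw [← h.quadRep_sum_smul c fun _ => ε] at h2
  rw [hdec, quadRep_add, add_mul, add_mul, map_add]
  linarith

/-! ### Functional calculus and gauges relative to the unit -/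

/-- The chosen value comes with its own decomposition of x, so independence of that choice is never
needed. -/
theorem funCalc_spec (f : ℝ → ℝ) (x : J) : IsFunctionOf f x (funCalc f x) := by
  have h : ∃ y, IsFunctionOf f x y := by
    obtain ⟨r, p, c, h⟩ := exists_isSpectralDecomposition x
    exact ⟨_, r, p, c, h, rfl⟩
  rw [funCalc, dif_pos h]
  exact Classical.choose_spec h

theorem IsOrthogonalSystem.quadRep_mem_cone_iff {r : ℕ} {p : Fin r → J}
    (h : IsOrthogonalSystem p) {c : Fin r → ℝ} (hc : ∀ i, 0 < c i) {y : J} :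
    quadRep (∑ k, c k • p k) y ∈ cone J ↔ y ∈ cone J := by
  refine ⟨fun hy => ?_, h.quadRep_mem_cone hc⟩
  have := h.quadRep_mem_cone (c := fun k => (c k)⁻¹) (fun k => inv_pos.2 (hc k)) hy
  rwa [h.quadRep_quadRep_inv fun i => mul_inv_cancel₀ (hc i).ne'] at this

/-- The gauge `M(y, e)` is the largest eigenvalue of `y`. -/
theorem IsSpectralDecomposition.gauge_unit {s : ℕ} {y e : J} {q : Fin s → J} {l : Fin s → ℝ}
    (h : IsSpectralDecomposition y q l) (he : ∀ x, e * x = x) (hl : ∀ i, 0 < l i) {k : Fin s}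
    (hk : ∀ i, l i ≤ l k) : gauge (cone J) y e = l k := by
  have hqe : ∑ i, q i = e := by rw [← h.1.sum_isUnit e, mul_comm, he]
  have hset : {t : ℝ | 0 < t ∧ t • e - y ∈ cone J} = Set.Ioi (l k) := by
    ext t
    have : t • e - y = ∑ i, (t - l i) • q i := by
      rw [← hqe, h.2, Finset.smul_sum, ← Finset.sum_sub_distrib]
      exact Finset.sum_congr rfl fun i _ => by module
    rw [Set.mem_ofPred_eq, this, h.1.sum_mem_cone_iff, Set.mem_Ioi]
    exact ⟨fun ht => sub_pos.1 (ht.2 k), fun ht => ⟨(hl k).trans ht, fun i =>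
      sub_pos.2 ((hk i).trans_lt ht)⟩⟩
  rw [gauge, hset, csInf_Ioi]

/-- The gauge `M(e, y)` is the inverse of the smallest eigenvalue of `y`. -/
theorem IsSpectralDecomposition.gauge_unit_left {s : ℕ} {y e : J} {q : Fin s → J}
    {l : Fin s → ℝ} (h : IsSpectralDecomposition y q l) (he : ∀ x, e * x = x)
    (hl : ∀ i, 0 < l i) {k : Fin s} (hk : ∀ i, l k ≤ l i) :
    gauge (cone J) e y = (l k)⁻¹ := by
  have hqe : ∑ i, q i = e := by rw [← h.1.sum_isUnit e, mul_comm, he]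
  have hset : {t : ℝ | 0 < t ∧ t • y - e ∈ cone J} = Set.Ioi (l k)⁻¹ := by
    ext t
    have : t • y - e = ∑ i, (t * l i - 1) • q i := by
      rw [← hqe, h.2, Finset.smul_sum, ← Finset.sum_sub_distrib]
      exact Finset.sum_congr rfl fun i _ => by module
    rw [Set.mem_ofPred_eq, this, h.1.sum_mem_cone_iff, Set.mem_Ioi]
    constructor
    · intro ht
      exact (inv_lt_iff_one_lt_mul₀ (hl k)).2 (sub_pos.1 (ht.2 k))
    · intro ht
      have ht0 : 0 < t := (inv_pos.2 (hl k)).trans ht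
      refine ⟨ht0, fun i => sub_pos.2 ?_⟩
      exact ((inv_lt_iff_one_lt_mul₀ (hl k)).1 ht).trans_le
        (mul_le_mul_of_nonneg_left (hk i) ht0.le)
  rw [gauge, hset, csInf_Ioi]

theorem diam_range_eq {ι : Type*} {f : ι → ℝ} {k m : ι} (hk : ∀ i, f k ≤ f i)
    (hm : ∀ i, f i ≤ f m) : Metric.diam (Set.range f) = f m - f k := by
  have hg : IsGreatest (Set.range f) (f m) := ⟨⟨m, rfl⟩, by rintro _ ⟨i, rfl⟩; exact hm i⟩
  have hl : IsLeast (Set.range f) (f k) := ⟨⟨k, rfl⟩, by rintro _ ⟨i, rfl⟩; exact hk i⟩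
  rw [Real.diam_eq (isBounded_iff_bddBelow_bddAbove.2 ⟨hl.bddBelow, hg.bddAbove⟩),
    hg.csSup_eq, hl.csInf_eq]

theorem sSup_abs_range_eq {ι : Type*} {f : ι → ℝ} {k m : ι} (hk : ∀ i, f k ≤ f i)
    (hm : ∀ i, f i ≤ f m) : sSup ((fun t : ℝ => |t|) '' Set.range f) = max (-f k) (f m) := by
  refine IsGreatest.csSup_eq ⟨?_, ?_⟩
  · rcases le_total (-f k) (f m) with h | h
    · refine ⟨f m, ⟨m, rfl⟩, ?_⟩
      rw [max_eq_right h]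
      exact abs_of_nonneg (by linarith [hk m])
    · refine ⟨f k, ⟨k, rfl⟩, ?_⟩
      rw [max_eq_left h]
      exact abs_of_nonpos (by linarith [hk m])
  · rintro _ ⟨_, ⟨i, rfl⟩, rfl⟩
    exact abs_le'.2 ⟨le_max_of_le_right (hm i), le_max_of_le_left (neg_le_neg (hk i))⟩

end EuclideanJordan

/-! ### The two metrics -/

theorem mainTheorem7 {J : Type*} [NonUnitalNonAssocCommRing J] [Module ℝ J]
    [EuclideanJordan.IsEuclideanJordanAlgebra J] [Nontrivial J]
    (a b : J) (ha : a ∈ EuclideanJordan.cone J) (hb : b ∈ EuclideanJordan.cone J) :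
    EuclideanJordan.quadRep (EuclideanJordan.rpow a (-1 / 2)) b ∈ EuclideanJordan.cone J ∧
    EuclideanJordan.hilbertDist (EuclideanJordan.cone J) a b =
      Metric.diam (Real.log ''
        EuclideanJordan.spec (EuclideanJordan.quadRep (EuclideanJordan.rpow a (-1 / 2)) b)) ∧
    EuclideanJordan.thompsonDist (EuclideanJordan.cone J) a b =
      EuclideanJordan.specNorm
        (EuclideanJordan.log (EuclideanJordan.quadRep (EuclideanJordan.rpow a (-1 / 2)) b)) := by
  open EuclideanJordan in
  obtain ⟨r, p, c, hac, hx⟩ := funCalc_spec (fun t : ℝ => t ^ (-1 / 2 : ℝ)) a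
  have hp := hac.1.isOrthogonalSystem
  have hc : ∀ i, 0 < c i := fun i => ha _ ⟨r, p, c, hac, i, rfl⟩
  have hd : ∀ i, 0 < c i ^ (-1 / 2 : ℝ) := fun i => Real.rpow_pos_of_pos (hc i) _
  have hmem : ∀ v, quadRep (rpow a (-1 / 2)) v ∈ cone J ↔ v ∈ cone J := fun v => by
    rw [rpow, hx]; exact hp.quadRep_mem_cone_iff hd
  have hxa : quadRep (rpow a (-1 / 2)) a = ∑ i, p i := by
    rw [rpow, hx]
    conv_lhs => rw [hac.2]
    rw [hp.quadRep_sum_smul]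
    refine Finset.sum_congr rfl fun i _ => ?_
    rw [← Real.rpow_add (hc i), show (-1 / 2 + -1 / 2 : ℝ) = -1 by norm_num, Real.rpow_neg_one,
      inv_mul_cancel₀ (hc i).ne', one_smul]
  set x := rpow a (-1 / 2)
  set y := quadRep x b with hy
  have hyC : y ∈ cone J := (hmem b).2 hb
  -- P(x) carries t b - a to t y - e without changing membership in the cone, so the two gauges are
  -- infima of the same set.
  have hgab : gauge (cone J) a b = gauge (cone J) (∑ i, p i) y := by
    simp only [EuclideanJordan.gauge, ← hmem (_ - a), quadRep_sub, quadRep_smul, hxa, ← hy]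
  have hgba : gauge (cone J) b a = gauge (cone J) y (∑ i, p i) := by
    simp only [EuclideanJordan.gauge, ← hmem (_ - b), quadRep_sub, quadRep_smul, hxa, ← hy]
  obtain ⟨s, q, l, hyl, hlog⟩ := funCalc_spec Real.log y
  have hl : ∀ i, 0 < l i := fun i => hyC _ ⟨s, q, l, hyl, i, rfl⟩
  have hne : Nonempty (Fin s) := by
    by_contra hs
    rw [not_nonempty_iff] at hs
    obtain ⟨v, hv⟩ := exists_ne (0 : J)
    exact hv (by rw [← hyl.1.sum_isUnit v]; simp)
  obtain ⟨k, hk⟩ := Finite.exists_min l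
  obtain ⟨m, hm⟩ := Finite.exists_max l
  rw [hyl.gauge_unit_left hp.sum_mul hl hk] at hgab
  rw [hyl.gauge_unit hp.sum_mul hl hm] at hgba
  have hk' : ∀ i, (Real.log ∘ l) k ≤ (Real.log ∘ l) i := fun i => Real.log_le_log (hl k) (hk i)
  have hm' : ∀ i, (Real.log ∘ l) i ≤ (Real.log ∘ l) m := fun i => Real.log_le_log (hl i) (hm i)
  refine ⟨hyC, ?_, ?_⟩
  · rw [hilbertDist, hgab, hgba, hyl.spec_eq, ← Set.range_comp, diam_range_eq hk' hm',
      Real.log_mul (inv_pos.2 (hl k)).ne' (hl m).ne', Real.log_inv]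
    simp only [Function.comp]
    ring
  -- The frame q serves both y and log y.
  · have hlogd : IsSpectralDecomposition (log y) q (Real.log ∘ l) := ⟨hyl.1, hlog⟩
    rw [thompsonDist, hgab, hgba, specNorm, hlogd.spec_eq, sSup_abs_range_eq hk' hm']
    simp only [Function.comp]
    rw [← Real.log_inv]
    exact Real.strictMonoOn_log.monotoneOn.map_max (inv_pos.2 (hl k)) (hl m)
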